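/- Let $\mathbb F$ be a finite field with $q$ elements. For $A\in\mathbb F^{n\times n}$ and $U,V\in\mathbb F^{n\times b}$ let $S=(U^{T}A^{i}V)_{i\ge 0}$. A polynomial matrix $G=\sum_i x^iG_i\in\mathbb F[x]^{b\times b}$ *generates* $S$ if $\det G\ne 0$ and $\sum_i S_{k+i}G_i=0$ for all $k\ge 0$; it *minimally generates* $S$ if in addition $\deg\det G$ is least among all generators of $S$. The invariant factors of a nonsingular square polynomial matrix are the monic diagonal entries of its Smith normal form, listed with the largest first (each divisible by the next) and continued by $1$'s beyond the size of the matrix. Say that $G$ is $r$-faithful to $A$ if the $r$ largest invariant factors of $G$ are the $r$ largest invariant factors of $xI-A$. Let $P_{q,b,r}(A)$ be the probability, for independent uniformly random $U,V\in\mathbb F^{n\times b}$, that a minimal generator $G$ of $S$ is $r$-faithful to $A$ (this does not depend on the choice of the minimal generator). For a prime power $m$ let $Q_{m,b,i}(t)$ be the probability that $\sum_{j=1}^t u_jv_j^{T}$ has rank $i$, where $u_1,\dots,u_t,v_1,\dots,v_t$ are independent and uniformly random in $K^b$, $K$ being a field with $m$ elements. **Theorem.** Let $f\in\mathbb F[x]$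 be monic irreducible of degree $d$, let $C_f\in\mathbb F^{d\times d}$ be its companion matrix, and let $b,r,t\ge 0$ be integers with $r\le t$. Then $$P_{q,b,r}\Big(\bigoplus_{i=1}^t C_f\Big)=\sum_{i=r}^{t}Q_{q^d,b,i}(t).$$ -/

import Mathlib

open Polynomial

namespace BlockWiedemann

/-- The `d × d` companion matrix `C_f` of a monic polynomial `f` of degree `d`: ones on the
subdiagonal, last column `(-f₀, …, -f_{d-1})ᵀ`, zeros elsewhere. -/
def companion {F : Type*} [Field F] (f : F[X]) :
    Matrix (Fin f.natDegree) (Fin f.natDegree) F :=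
  Matrix.of fun i j =>
    if (j : ℕ) + 1 = f.natDegree then -f.coeff i
    else if (i : ℕ) = (j : ℕ) + 1 then 1
    else 0

/-- The block diagonal matrix `C_f ⊕ ⋯ ⊕ C_f` with `t` blocks; its rows and columns are indexed by
pairs (position inside the block, block). -/
def companionSum {F : Type*} [Field F] (f : F[X]) (t : ℕ) :
    Matrix (Fin f.natDegree × Fin t) (Fin f.natDegree × Fin t) F :=
  Matrix.blockDiagonal fun _ : Fin t => companion f

/-- The `(U, V)`-projection of `A`: the matrix sequence `Uᵀ Aⁱ V`, `i = 0, 1, 2, …`. -/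
def projection {F : Type*} [Field F] {n : Type*} [Fintype n] [DecidableEq n] {b : ℕ}
    (A : Matrix n n F) (U V : Matrix n (Fin b) F) : ℕ → Matrix (Fin b) (Fin b) F :=
  fun i => U.transpose * A ^ i * V

/-- The right action of matrix polynomials on matrix sequences: `(S G)_k = ∑ i, S_{k+i} G_i`, where
`G = ∑ i, xⁱ G_i`. -/
noncomputable def seqMul {F : Type*} [Field F] {b : ℕ} (S : ℕ → Matrix (Fin b) (Fin b) F)
    (G : Matrix (Fin b) (Fin b) F[X]) : ℕ → Matrix (Fin b) (Fin b) F :=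
  fun k => (matPolyEquiv G).sum fun i Gi => S (k + i) * Gi

/-- `G` generates `S` if `det G ≠ 0` and `S G = 0`. -/
def Generates {F : Type*} [Field F] {b : ℕ} (G : Matrix (Fin b) (Fin b) F[X])
    (S : ℕ → Matrix (Fin b) (Fin b) F) : Prop :=
  G.det ≠ 0 ∧ ∀ k, seqMul S G k = 0

/-- `G` minimally generates `S`: it generates `S` and `deg (det G)` is least possible. -/
def MinimallyGenerates {F : Type*} [Field F] {b : ℕ} (G : Matrix (Fin b) (Fin b) F[X])
    (S : ℕ → Matrix (Fin b) (Fin b) F) : Prop :=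
  Generates G S ∧
    ∀ H : Matrix (Fin b) (Fin b) F[X], Generates H S → G.det.natDegree ≤ H.det.natDegree

/-- `s 0, s 1, …` are the invariant factors of the square polynomial matrix `M`, largest first:
`M` is unimodularly equivalent to the diagonal matrix with diagonal `s 0, …, s (m - 1)` (where `m`
is the size of `M`), each entry is monic or zero, and `s j ∣ s i` for `i ≤ j`. The list is
continued beyond the size of `M` by the trivial invariant factor `1`. -/
structure IsInvariantFactors {F : Type*} [Field F] {n : Type*} [Fintype n] [DecidableEq n]
    (M : Matrix n n F[X]) (s : ℕ → F[X]) : Prop where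
  monic_or_zero : ∀ i, s i = 0 ∨ (s i).Monic
  dvd : ∀ i j, i ≤ j → s j ∣ s i
  eq_one : ∀ i, Fintype.card n ≤ i → s i = 1
  equivalent : ∃ (e : n ≃ Fin (Fintype.card n)) (P Q : Matrix n n F[X]),
    IsUnit P ∧ IsUnit Q ∧ P * M * Q = Matrix.diagonal fun i => s (e i)

/-- `G` is `r`-faithful to `A`: the `r` largest invariant factors of `G` are the `r` largest
invariant factors of `x I - A`. -/
def Faithful {F : Type*} [Field F] {n : Type*} [Fintype n] [DecidableEq n] {b : ℕ} (r : ℕ)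
    (G : Matrix (Fin b) (Fin b) F[X]) (A : Matrix n n F) : Prop :=
  ∃ s s' : ℕ → F[X], IsInvariantFactors G s ∧ IsInvariantFactors A.charmatrix s' ∧
    ∀ i < r, s i = s' i

/-- The probability, for `U, V` uniformly random in `F^{n × b}` and independent, that the minimal
generator `G` of the `(U, V)`-projection of `A` is `r`-faithful to `A`. (Minimal generators of one
sequence are unimodularly equivalent, so faithfulness does not depend on which one is taken.) -/
noncomputable def faithfulProb {F : Type*} [Field F] {n : Type*} [Fintype n] [DecidableEq n]
    (b r : ℕ) (A : Matrix n n F) : ℝ :=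
  (Nat.card {p : Matrix n (Fin b) F × Matrix n (Fin b) F //
      ∃ G : Matrix (Fin b) (Fin b) F[X],
        MinimallyGenerates G (projection A p.1 p.2) ∧ Faithful r G A} : ℝ) /
    (Nat.card (Matrix n (Fin b) F × Matrix n (Fin b) F) : ℝ)

/-- The probability that `∑_{i=1}^t u_i v_iᵀ` has rank `r`, for independent uniformly random
vectors `u_i, v_i ∈ K^b`. -/
noncomputable def outerProductRankProb (K : Type*) [Field K] (b r t : ℕ) : ℝ :=
  (Nat.card {p : (Fin t → Fin b → K) × (Fin t → Fin b → K) //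
      (∑ i, Matrix.vecMulVec (p.1 i) (p.2 i)).rank = r} : ℝ) /
    (Nat.card ((Fin t → Fin b → K) × (Fin t → Fin b → K)) : ℝ)

end BlockWiedemann

/-! Let `L = F[x]/(f)`. Each block of `F^d` is a copy of `L` on which `C_f` multiplies by the root.
Reading `V` in the power basis and `U` in its trace-dual basis is a bijection onto pairs of families
`u_j, v_j ∈ L^b`, and it turns the projection into `Tr(root^k W)` with `W = ∑ u_j v_jᵀ`
(`projection_companionSum`). The trace form is nondegenerate, so a nonsingular `G` generates iff `W
G ≡ 0` mod `f` (`generates_iff_of_trace`). The columns of a minimal generator therefore span the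
lattice of all `v` with `W v ≡ 0` (`exists_minimal_annihilator`). This lattice contains `f F[x]^b`,
so the invariant factors are `f` or `1`, and `f` occurs `rank W` times (`rank_map_eq_of_kernel`).
For `xI - A` it occurs `t` times. Hence `r`-faithful means `r ≤ rank W`, and counting pairs finishes
the proof. -/

namespace BlockWiedemann

/-! ### Smith forms whose diagonal entries are `1` or `f` -/

section Smith

variable {F : Type*} [Field F] {ι : Type*} [Fintype ι] [DecidableEq ι] {f : F[X]}

/-- Since `f F[x]^ι ⊆ N`, the module `N` has full rank and every elementary divisor divides `f`. -/
theorem exists_smith_of_irreducible_smul_mem (hf : Irreducible f)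
    (N : Submodule F[X] (ι → F[X])) (hN : ∀ v, f • v ∈ N) :
    ∃ (P : Matrix ι ι F[X]) (a : ι → F[X]), IsUnit P ∧ (∀ i, a i = 1 ∨ a i = f) ∧
      ∀ v, v ∈ N ↔ ∃ w, v = (P * Matrix.diagonal a).mulVec w := by
  obtain ⟨n, snf⟩ := N.smithNormalForm (Pi.basisFun F[X] ι)
  have hrange : ∀ i, ∃ j, snf.f j = i ∧ snf.a j ∣ f := by
    intro i
    have h1 : snf.bM.repr (f • snf.bM i) i = f := by simp
    by_cases hi : i ∈ Set.range snf.f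
    · obtain ⟨j, rfl⟩ := hi
      refine ⟨j, rfl, ?_⟩
      have h2 := snf.repr_apply_embedding_eq_repr_smul ⟨_, hN (snf.bM (snf.f j))⟩ (i := j)
      rw [h1] at h2
      rw [h2, map_smul]
      exact dvd_mul_right _ _
    -- A missed index would force the `i`-th coordinate to vanish on `N`, but `f • snf.bM i` has
    -- coordinate `f` there.
    · have h2 := snf.repr_eq_zero_of_notMem_range ⟨_, hN (snf.bM i)⟩ hi
      exact absurd (h1.symm.trans h2) hf.ne_zero
  choose g hg hgf using hrange
  have hc : ∀ i, ∃ c, (c = 1 ∨ c = f) ∧ Associated (snf.a (g i)) c := by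
    intro i
    rcases hf.dvd_iff.mp (hgf i) with h | h
    · exact ⟨1, Or.inl rfl, associated_one_iff_isUnit.mpr h⟩
    · exact ⟨f, Or.inr rfl, h.symm⟩
  choose c hc1 hca using hc
  have hmem : ∀ v, v ∈ N ↔ ∀ i, c i ∣ snf.bM.repr v i := by
    intro v
    constructor
    · intro hv i
      have h2 := snf.repr_apply_embedding_eq_repr_smul ⟨v, hv⟩ (i := g i)
      rw [hg] at h2
      refine (hca i).symm.dvd.trans ?_
      simp only at h2
      rw [h2, map_smul]
      exact dvd_mul_right _ _
    · intro h
      rw [← snf.bM.sum_repr v]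
      refine N.sum_mem fun i _ => ?_
      obtain ⟨w, hw⟩ := (hca i).dvd.trans (h i)
      rw [hw, mul_comm, mul_smul]
      refine N.smul_mem _ ?_
      have := snf.snf (g i)
      rw [hg] at this
      rw [← this]
      exact (snf.bN _).2
  refine ⟨(Pi.basisFun F[X] ι).toMatrix snf.bM, c, ?_, hc1, fun v => ?_⟩
  · let := (Pi.basisFun F[X] ι).invertibleToMatrix snf.bM
    exact isUnit_of_invertible _
  · have hP : ∀ w, snf.bM.repr (((Pi.basisFun F[X] ι).toMatrix snf.bM).mulVec w) = w := by
      intro w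
      have h3 := snf.bM.toMatrix_mulVec_repr (Pi.basisFun F[X] ι) (snf.bM.equivFun.symm w)
      have h4 : (snf.bM.repr (snf.bM.equivFun.symm w) : ι → F[X]) = w :=
        snf.bM.equivFun.apply_symm_apply w
      rw [h4] at h3
      have h5 : ((Pi.basisFun F[X] ι).toMatrix snf.bM).mulVec w = snf.bM.equivFun.symm w := h3
      rw [h5, h4]
    rw [hmem]
    constructor
    · intro h
      choose w hw using h
      refine ⟨w, ?_⟩
      rw [← Matrix.mulVec_mulVec]
      apply snf.bM.repr.injective
      ext1 i
      rw [hP, hw, Matrix.mulVec_diagonal]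
    · rintro ⟨w, rfl⟩ i
      rw [← Matrix.mulVec_mulVec, hP, Matrix.mulVec_diagonal]
      exact dvd_mul_right _ _

theorem rank_eq_card_of_equiv_diagonal {E : Type*} [Field E] [DecidableEq E]
    {P M Q : Matrix ι ι E} {D : ι → E} (hP : IsUnit P) (hQ : IsUnit Q)
    (h : P * M * Q = Matrix.diagonal D) : M.rank = Fintype.card {i // D i ≠ 0} := by
  rw [← Matrix.rank_diagonal, ← h,
    Matrix.rank_mul_eq_left_of_isUnit_det _ _ ((Matrix.isUnit_iff_isUnit_det _).mp hQ),
    Matrix.rank_mul_eq_right_of_isUnit_det _ _ ((Matrix.isUnit_iff_isUnit_det _).mp hP)]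

-- Sorts the diagonal so that the entries equal to `f` come first.
omit [DecidableEq ι] in
theorem exists_equiv_fin_lt (p : ι → Prop) :
    ∃ (k : ℕ) (e : ι ≃ Fin (Fintype.card ι)), k ≤ Fintype.card ι ∧ ∀ i, p i ↔ (e i : ℕ) < k := by
  classical
  let e : ι ≃ Fin (Fintype.card {i // p i} + Fintype.card {i // ¬ p i}) :=
    (Equiv.sumCompl p).symm.trans
      ((Equiv.sumCongr (Fintype.equivFin _) (Fintype.equivFin _)).trans finSumFinEquiv)
  have hcard := Fintype.card_congr e
  rw [Fintype.card_fin] at hcard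
  refine ⟨Fintype.card {i // p i}, e.trans (finCongr hcard.symm), by omega, fun i => ?_⟩
  by_cases hi : p i
  · simp [e, hi, Equiv.sumCompl_symm_apply_of_pos]
  · simp [e, hi, Equiv.sumCompl_symm_apply_of_neg]

/-- Modulo `f` the unimodular factors stay invertible and exactly the entries divisible by `f` die,
so the corank counts them; the divisibility chain makes them an initial segment. -/
theorem IsInvariantFactors.dvd_iff {M : Matrix ι ι F[X]} [Fact (Irreducible f)] {s : ℕ → F[X]}
    (h : IsInvariantFactors M s) (i : ℕ) :
    f ∣ s i ↔ i < Fintype.card ι - (M.map (AdjoinRoot.mk f)).rank := by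
  classical
  have hf : Irreducible f := Fact.out
  obtain ⟨e, P, Q, hP, hQ, hM⟩ := h.equivalent
  have hr : (M.map (AdjoinRoot.mk f)).rank = Fintype.card {i // ¬ f ∣ s (e i)} := by
    have h1 := congrArg (AdjoinRoot.mk f).mapMatrix hM
    simp only [map_mul] at h1
    rw [RingHom.mapMatrix_apply, RingHom.mapMatrix_apply, RingHom.mapMatrix_apply,
      RingHom.mapMatrix_apply, Matrix.diagonal_map (map_zero _)] at h1
    rw [rank_eq_card_of_equiv_diagonal (hP.map (AdjoinRoot.mk f).mapMatrix)
      (hQ.map (AdjoinRoot.mk f).mapMatrix) h1]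
    exact Fintype.card_congr (Equiv.subtypeEquivRight fun i => by simp [AdjoinRoot.mk_eq_zero])
  have hcompl := Fintype.card_subtype_compl (fun i => f ∣ s (e i))
  have hle := Fintype.card_subtype_le (fun i => f ∣ s (e i))
  have hk : Fintype.card ι - (M.map (AdjoinRoot.mk f)).rank =
      Fintype.card {i // f ∣ s (e i)} := by omega
  rw [hk]
  have hcount : Fintype.card {i // f ∣ s (e i)} =
      ((Finset.range (Fintype.card ι)).filter fun i => f ∣ s i).card := by
    rw [Fintype.card_subtype]
    refine Finset.card_bij (fun i _ => (e i : ℕ)) ?_ ?_ ?_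
    · intro i hi; simpa using hi
    · intro i _ j _ hij; exact e.injective (Fin.ext hij)
    · intro j hj
      simp only [Finset.mem_filter, Finset.mem_range] at hj
      exact ⟨e.symm ⟨j, hj.1⟩, by simpa using hj.2, by simp⟩
  rw [hcount]
  have hlt : ∀ i, f ∣ s i → i < Fintype.card ι := by
    intro i hi
    by_contra hc
    rw [h.eq_one i (not_lt.mp hc)] at hi
    exact hf.not_isUnit (isUnit_of_dvd_one hi)
  constructor
  · intro hi
    have : Finset.range (i + 1) ⊆ (Finset.range (Fintype.card ι)).filter fun i => f ∣ s i := by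
      intro j hj
      have : f ∣ s j := hi.trans (h.dvd j i (by simpa [Nat.lt_succ_iff] using hj))
      simp [this, hlt j this]
    simpa [Nat.succ_le_iff] using Finset.card_le_card this
  · intro hi
    by_contra hc
    have : ((Finset.range (Fintype.card ι)).filter fun i => f ∣ s i) ⊆ Finset.range i := by
      intro j hj
      simp only [Finset.mem_filter, Finset.mem_range] at hj ⊢
      by_contra hji
      exact hc (hj.2.trans (h.dvd i j (not_lt.mp hji)))
    have := Finset.card_le_card this
    rw [Finset.card_range] at this
    omega

/-- `M` and the Smith basis `P * diagonal a` span the same column module, so they differ by a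
unimodular factor on the right. -/
theorem isInvariantFactors_of_dvd [Fact (Irreducible f)] (hmonic : f.Monic) {M : Matrix ι ι F[X]}
    (hdet : M.det ≠ 0) (hM : ∀ v, ∃ w, f • v = M.mulVec w) :
    IsInvariantFactors M fun i =>
      if i < Fintype.card ι - (M.map (AdjoinRoot.mk f)).rank then f else 1 := by
  have hf : Irreducible f := Fact.out
  have hf1 : ¬ f ∣ 1 := fun h => hf.not_isUnit (isUnit_of_dvd_one h)
  obtain ⟨P, a, hP, ha, hN⟩ := exists_smith_of_irreducible_smul_mem hf
    (LinearMap.range M.mulVecLin) (fun v => by obtain ⟨w, hw⟩ := hM v; exact ⟨w, hw.symm⟩)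
  have h1 : ∀ i, ∃ w, M.col i = (P * Matrix.diagonal a).mulVec w := fun i =>
    (hN _).mp ⟨Pi.single i 1, by simp⟩
  have h2 : ∀ i, ∃ w, (P * Matrix.diagonal a).col i = M.mulVec w := fun i => by
    obtain ⟨w, hw⟩ := (hN _).mpr ⟨Pi.single i 1, rfl⟩
    exact ⟨w, by simpa using hw.symm⟩
  choose T hT using h1
  choose T' hT' using h2
  have hT1 : M = P * Matrix.diagonal a * (Matrix.of T).transpose := by
    ext1 i j
    exact congrFun (hT j) i
  have hT2 : P * Matrix.diagonal a = M * (Matrix.of T').transpose := by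
    ext1 i j
    exact congrFun (hT' j) i
  have hTT : (Matrix.of T').transpose * (Matrix.of T).transpose = 1 := by
    have h3 : M * ((Matrix.of T').transpose * (Matrix.of T).transpose) = M * 1 := by
      rw [← mul_assoc, ← hT2, ← hT1, mul_one]
    refine Matrix.ext_of_mulVec_single fun i => Matrix.mulVec_injective_of_det_ne_zero hdet ?_
    rw [Matrix.mulVec_mulVec, Matrix.mulVec_mulVec, h3]
  obtain ⟨k, e, hk, hek⟩ := exists_equiv_fin_lt (fun i => a i = f)
  have key : IsInvariantFactors M fun i => if i < k then f else 1 := by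
    refine ⟨fun i => ?_, fun i j hij => ?_, fun i hi => if_neg (by omega), e,
      ((hP.unit⁻¹ : (Matrix ι ι F[X])ˣ) : Matrix ι ι F[X]), (Matrix.of T').transpose,
      Units.isUnit _, ?_, ?_⟩
    · split_ifs
      exacts [Or.inr hmonic, Or.inr monic_one]
    · split_ifs
      · rfl
      · omega
      · exact one_dvd _
      · rfl
    · exact IsUnit.of_mul_eq_one _ hTT
    · rw [mul_assoc, ← hT2, ← mul_assoc, IsUnit.val_inv_mul, one_mul]
      congr 1
      ext1 i
      by_cases hi : a i = f
      · rw [if_pos ((hek i).mp hi), hi]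
      · rw [if_neg (fun h => hi ((hek i).mpr h)), (ha i).resolve_right hi]
  -- `k` is not counted directly: `dvd_iff`, applied to the form just found, already fixes it.
  have hk' : k = Fintype.card ι - (M.map (AdjoinRoot.mk f)).rank := by
    have h4 : ∀ i, i < k ↔ i < Fintype.card ι - (M.map (AdjoinRoot.mk f)).rank := by
      intro i
      rw [← key.dvd_iff]
      split_ifs with h <;> simp [h, hf1]
    exact le_antisymm (not_lt.mp fun h => lt_irrefl _ ((h4 _).mp h))
      (not_lt.mp fun h => lt_irrefl _ ((h4 _).mpr h))
  rwa [← hk']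

end Smith

/-! ### The kernel lattice of `W` modulo `f` -/

section Lattice

variable {F : Type*} [Field F] {ι : Type*} [Fintype ι] [DecidableEq ι] {f : F[X]}

/-- The columns of `H` form a basis of the kernel lattice, so any competitor is `G = H T`. Equality
of determinant degrees makes `det T` a nonzero constant, and then `G` spans the same lattice. -/
theorem exists_minimal_annihilator [Fact (Irreducible f)] (W : Matrix ι ι (AdjoinRoot f)) :
    ∃ H : Matrix ι ι F[X], (H.det ≠ 0 ∧ W * H.map (AdjoinRoot.mk f) = 0) ∧
      ∀ G : Matrix ι ι F[X], G.det ≠ 0 → W * G.map (AdjoinRoot.mk f) = 0 →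
        H.det.natDegree ≤ G.det.natDegree ∧
        (G.det.natDegree ≤ H.det.natDegree →
          ∀ v : ι → F[X], W.mulVec (AdjoinRoot.mk f ∘ v) = 0 → ∃ w, v = G.mulVec w) := by
  have hf : Irreducible f := Fact.out
  let N : Submodule F[X] (ι → F[X]) :=
    { carrier := {v | W.mulVec (AdjoinRoot.mk f ∘ v) = 0}
      add_mem' := fun {v w} hv hw => by
        have : AdjoinRoot.mk f ∘ (v + w) = AdjoinRoot.mk f ∘ v + AdjoinRoot.mk f ∘ w := by
          ext i; simp
        rw [Set.mem_ofPred_eq] at *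
        rw [this, Matrix.mulVec_add, hv, hw, add_zero]
      zero_mem' := by
        have : AdjoinRoot.mk f ∘ (0 : ι → F[X]) = 0 := by ext i; simp
        rw [Set.mem_ofPred_eq, this, Matrix.mulVec_zero]
      smul_mem' := fun c v hv => by
        have : AdjoinRoot.mk f ∘ (c • v) = AdjoinRoot.mk f c • (AdjoinRoot.mk f ∘ v) := by
          ext i; simp
        rw [Set.mem_ofPred_eq] at *
        rw [this, Matrix.mulVec_smul, hv, smul_zero] }
  have hmem : ∀ v, v ∈ N ↔ W.mulVec (AdjoinRoot.mk f ∘ v) = 0 := fun v => Iff.rfl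
  obtain ⟨P, a, hP, ha, hN⟩ := exists_smith_of_irreducible_smul_mem hf N
    (fun v => by
      rw [hmem]
      have : AdjoinRoot.mk f ∘ (f • v) = 0 := by ext i; simp
      rw [this, Matrix.mulVec_zero])
  have hcol : ∀ G : Matrix ι ι F[X], W * G.map (AdjoinRoot.mk f) = 0 ↔
      ∀ j, G.col j ∈ N := by
    intro G
    simp only [hmem, ← Matrix.ext_iff, funext_iff]
    exact ⟨fun h j i => h i j, fun h i j => h j i⟩
  have ha0 : ∀ i, a i ≠ 0 := fun i => by
    rcases ha i with h | h <;> rw [h]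
    exacts [one_ne_zero, hf.ne_zero]
  refine ⟨P * Matrix.diagonal a, ⟨?_, ?_⟩, fun G hG hWG => ?_⟩
  · rw [Matrix.det_mul, Matrix.det_diagonal]
    exact mul_ne_zero ((Matrix.isUnit_iff_isUnit_det _).mp hP).ne_zero
      (Finset.prod_ne_zero_iff.mpr fun i _ => ha0 i)
  · rw [hcol]
    exact fun j => (hN _).mpr ⟨Pi.single j 1, by simp⟩
  · rw [hcol] at hWG
    choose T hT using fun j => (hN _).mp (hWG j)
    have hGT : G = P * Matrix.diagonal a * (Matrix.of T).transpose := by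
      ext1 i j
      exact congrFun (hT j) i
    set H := P * Matrix.diagonal a
    have hdet := congrArg Matrix.det hGT
    rw [Matrix.det_mul] at hdet
    have hH0 : H.det ≠ 0 := fun h => hG (by rw [hdet, h, zero_mul])
    have hT0 : (Matrix.of T).transpose.det ≠ 0 := fun h => hG (by rw [hdet, h, mul_zero])
    have hdeg := congrArg natDegree hdet
    rw [natDegree_mul hH0 hT0] at hdeg
    refine ⟨by omega, fun hle v hv => ?_⟩
    have hu : IsUnit (Matrix.of T).transpose := by
      rw [Matrix.isUnit_iff_isUnit_det, isUnit_iff_degree_eq_zero, degree_eq_natDegree hT0]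
      norm_cast
      omega
    obtain ⟨w, hw⟩ := (hN v).mp hv
    refine ⟨((hu.unit⁻¹ : (Matrix ι ι F[X])ˣ) : Matrix ι ι F[X]).mulVec w, ?_⟩
    rw [hw, hGT, Matrix.mulVec_mulVec, mul_assoc, IsUnit.mul_val_inv, mul_one]

-- The image of `G` mod `f` is exactly `ker W`; rank-nullity does the rest.
omit [DecidableEq ι] in
theorem rank_map_eq_of_kernel [Fact (Irreducible f)] {W : Matrix ι ι (AdjoinRoot f)}
    {G : Matrix ι ι F[X]} (h0 : W * G.map (AdjoinRoot.mk f) = 0)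
    (h : ∀ v : ι → F[X], W.mulVec (AdjoinRoot.mk f ∘ v) = 0 → ∃ w, v = G.mulVec w) :
    Fintype.card ι - (G.map (AdjoinRoot.mk f)).rank = W.rank := by
  have hker : LinearMap.range (G.map (AdjoinRoot.mk f)).mulVecLin = LinearMap.ker W.mulVecLin := by
    ext y
    constructor
    · rintro ⟨x, rfl⟩
      simp [h0]
    · intro hy
      choose v hv using fun i => AdjoinRoot.mk_surjective (g := f) (y i)
      have hv' : AdjoinRoot.mk f ∘ v = y := funext hv
      obtain ⟨w, rfl⟩ := h v (by rw [hv']; exact hy)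
      refine ⟨AdjoinRoot.mk f ∘ w, ?_⟩
      rw [← hv']
      ext i
      exact (RingHom.map_mulVec (AdjoinRoot.mk f) G w i).symm
  have h1 := LinearMap.finrank_range_add_finrank_ker W.mulVecLin
  rw [← hker, Module.finrank_fintype_fun_eq_card] at h1
  change W.rank + (G.map (AdjoinRoot.mk f)).rank = _ at h1
  omega

end Lattice

/-! ### Invariant factors of `xI - A` when `f(A) = 0` -/

section Charmatrix

variable {F : Type*} [Field F] {n : Type*} [Fintype n] [DecidableEq n] {f : F[X]}

/-- `xI` and `A` commute, so `xI - A` divides `f(xI) - f(A) = f I`, monomial by monomial. -/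
theorem exists_smul_eq_charmatrix_mulVec {A : Matrix n n F} (hA : aeval A f = 0) (v : n → F[X]) :
    ∃ w, f • v = A.charmatrix.mulVec w := by
  have hdvd : A.charmatrix ∣ f • (1 : Matrix n n F[X]) := by
    have hX : (f • (1 : Matrix n n F[X])) = aeval ((X : F[X]) • (1 : Matrix n n F[X])) f := by
      have := aeval_algebraMap_apply (Matrix n n F[X]) (X : F[X]) f
      rw [Algebra.algebraMap_eq_smul_one, Algebra.algebraMap_eq_smul_one] at this
      rw [this, aeval_X_left_apply]
    have hC : aeval (C.mapMatrix A : Matrix n n F[X]) f = 0 := by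
      have := aeval_algHom_apply (Algebra.ofId F F[X]).mapMatrix A f
      rw [hA, map_zero] at this
      exact this
    rw [hX, ← sub_zero (aeval _ f), ← hC, aeval_eq_sum_range, aeval_eq_sum_range,
      ← Finset.sum_sub_distrib]
    refine Finset.dvd_sum fun i _ => ?_
    rw [← smul_sub]
    have hcomm : Commute ((X : F[X]) • (1 : Matrix n n F[X])) (C.mapMatrix A) :=
      (Commute.one_left _).smul_left _
    have hch : A.charmatrix = (X : F[X]) • (1 : Matrix n n F[X]) - C.mapMatrix A := by
      rw [Matrix.charmatrix, Matrix.scalar_apply, Matrix.smul_one_eq_diagonal]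
    obtain ⟨B, hB⟩ := hcomm.sub_dvd_pow_sub_pow i
    exact ⟨f.coeff i • B, by rw [hch, hB, Matrix.mul_smul]⟩
  obtain ⟨B, hB⟩ := hdvd
  refine ⟨B.mulVec v, ?_⟩
  rw [Matrix.mulVec_mulVec, ← hB, Matrix.smul_mulVec, Matrix.one_mulVec]

theorem charmatrix_det_ne_zero (A : Matrix n n F) : A.charmatrix.det ≠ 0 :=
  A.charpoly_monic.ne_zero

/-- Compares the degree of the characteristic polynomial with that of its Smith form, a power of
`f`. -/
theorem natDegree_mul_corank_charmatrix [Fact (Irreducible f)] (hmonic : f.Monic)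
    {A : Matrix n n F} (hA : aeval A f = 0) :
    (Fintype.card n - (A.charmatrix.map (AdjoinRoot.mk f)).rank) * f.natDegree =
      Fintype.card n := by
  obtain ⟨e, P, Q, hP, hQ, hM⟩ := (isInvariantFactors_of_dvd hmonic (charmatrix_det_ne_zero A)
    (exists_smul_eq_charmatrix_mulVec hA)).equivalent
  set k := Fintype.card n - (A.charmatrix.map (AdjoinRoot.mk f)).rank with hk
  have hdet := congrArg (fun B => natDegree (Matrix.det B)) hM
  simp only [Matrix.det_mul, Matrix.det_diagonal] at hdet
  rw [Matrix.isUnit_iff_isUnit_det] at hP hQ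
  rw [natDegree_mul (mul_ne_zero hP.ne_zero (charmatrix_det_ne_zero A)) hQ.ne_zero,
    natDegree_mul hP.ne_zero (charmatrix_det_ne_zero A), natDegree_eq_zero_of_isUnit hP,
    natDegree_eq_zero_of_isUnit hQ, zero_add, add_zero,
    e.prod_comp (fun j => if (j : ℕ) < k then f else 1),
    Fin.prod_univ_eq_prod_range (fun j => if j < k then f else 1), Finset.prod_ite,
    Finset.prod_const, Finset.prod_const_one, mul_one, natDegree_pow] at hdet
  have hfilter : (Finset.range (Fintype.card n)).filter (· < k) = Finset.range k := by
    ext j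
    simp only [Finset.mem_filter, Finset.mem_range]
    omega
  rw [hfilter, Finset.card_range] at hdet
  rw [← hdet]
  exact A.charpoly_natDegree_eq_dim

end Charmatrix

/-! ### Companion blocks as multiplication in `F[x]/(f)` -/

section Companion

variable {F : Type*} [Field F] {f : F[X]}

/-- The basis `1, x, …, x^(d-1)` of `F[x]/(f)`, indexed by `Fin d` with `d = deg f`. -/
noncomputable def powersBasis (hmonic : f.Monic) :
    Module.Basis (Fin f.natDegree) F (AdjoinRoot f) :=
  (AdjoinRoot.powerBasis' hmonic).basis

theorem powersBasis_apply (hmonic : f.Monic) (i : Fin f.natDegree) :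
    powersBasis hmonic i = AdjoinRoot.root f ^ (i : ℕ) :=
  (AdjoinRoot.powerBasis' hmonic).basis_eq_pow i

theorem companion_eq_leftMulMatrix (hmonic : f.Monic) :
    companion f =
      Algebra.leftMulMatrix (powersBasis hmonic) (AdjoinRoot.root f) := by
  have h := (AdjoinRoot.powerBasis' hmonic).leftMulMatrix
  have hm : (AdjoinRoot.powerBasis' hmonic).minpolyGen = f := by
    rw [PowerBasis.minpolyGen_eq, AdjoinRoot.powerBasis'_gen,
      AdjoinRoot.minpoly_root hmonic.ne_zero, hmonic.leadingCoeff, inv_one, C.map_one, mul_one]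
  rw [hm] at h
  exact h.symm

theorem aeval_companion (hmonic : f.Monic) : aeval (companion f) f = 0 := by
  rw [companion_eq_leftMulMatrix hmonic, aeval_algHom_apply, AdjoinRoot.aeval_eq,
    AdjoinRoot.mk_self, map_zero]

theorem companionSum_pow (f : F[X]) (t k : ℕ) :
    companionSum f t ^ k = Matrix.blockDiagonal fun _ : Fin t => companion f ^ k :=
  (Matrix.blockDiagonal_pow _ k).symm

theorem aeval_companionSum (hmonic : f.Monic) (t : ℕ) : aeval (companionSum f t) f = 0 := by
  have h := aeval_companion hmonic
  rw [aeval_eq_sum_range] at h ⊢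
  simp_rw [companionSum_pow]
  ext ⟨p, j⟩ ⟨q, l⟩
  simp only [Matrix.sum_apply, Matrix.smul_apply, Matrix.blockDiagonal_apply, Matrix.zero_apply]
  by_cases hjl : j = l
  · simpa [hjl, Matrix.sum_apply] using congrFun (congrFun h p) q
  · simp [hjl]

theorem companionSum_pow_mulVec (hmonic : f.Monic) (t k : ℕ) (v : Fin f.natDegree × Fin t → F)
    (p : Fin f.natDegree) (j : Fin t) :
    ((companionSum f t ^ k).mulVec v) (p, j) =
      (powersBasis hmonic).repr (AdjoinRoot.root f ^ k *
        (powersBasis hmonic).equivFun.symm fun q => v (q, j)) p := by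
  have h1 : ((companionSum f t ^ k).mulVec v) (p, j) =
      ((companion f ^ k).mulVec fun q => v (q, j)) p := by
    rw [companionSum_pow]
    simp [Matrix.mulVec, dotProduct, Fintype.sum_prod_type, Matrix.blockDiagonal_apply]
  rw [h1, companion_eq_leftMulMatrix hmonic, ← map_pow,
    ← Algebra.leftMulMatrix_mulVec_repr]
  congr 2
  exact ((powersBasis hmonic).equivFun.apply_symm_apply _).symm

/-- Turns the dot product over `E` into a trace of a product in `L`; this is why `U` is read in the
dual basis. -/
theorem trace_traceDual_mul {E L ι : Type*} [Field E] [Field L] [Algebra E L]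
    [FiniteDimensional E L] [Algebra.IsSeparable E L] [Fintype ι] [DecidableEq ι]
    (B : Module.Basis ι E L) (x : ι → E) (z : L) :
    Algebra.trace E L (B.traceDual.equivFun.symm x * z) = ∑ p, x p * B.repr z p := by
  conv_lhs => rw [← B.sum_repr z, Module.Basis.equivFun_symm_apply]
  rw [B.sum_repr z, Finset.sum_mul, map_sum]
  refine Finset.sum_congr rfl fun p _ => ?_
  rw [smul_mul_assoc, map_smul, smul_eq_mul]
  congr 1
  conv_lhs => rw [← B.sum_repr z, Finset.mul_sum, map_sum]
  simp

end Companion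

/-! ### The projection as a trace sequence -/

section Projection

variable {F : Type*} [Field F] [Finite F] {f : F[X]}

/-- Coordinates of an `n × b` matrix, read blockwise in a basis of `F[x]/(f)`. -/
noncomputable def blockCoordEquiv {E L ι : Type*} [Field E] [Field L] [Algebra E L] [Fintype ι]
    (B : Module.Basis ι E L) (b t : ℕ) :
    Matrix (ι × Fin t) (Fin b) E ≃ (Fin t → Fin b → L) where
  toFun V j c := B.equivFun.symm fun q => V (q, j) c
  invFun v := Matrix.of fun p c => B.equivFun (v p.2 c) p.1
  left_inv V := by
    ext ⟨q, j⟩ c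
    simp only [Matrix.of_apply, LinearEquiv.apply_symm_apply]
  right_inv v := by
    ext j c
    simp only [Matrix.of_apply]
    exact B.equivFun.symm_apply_apply _

theorem projection_companionSum [Fact (Irreducible f)] [FiniteDimensional F (AdjoinRoot f)]
    (hmonic : f.Monic) {b t : ℕ}
    (U V : Matrix (Fin f.natDegree × Fin t) (Fin b) F) (k : ℕ) (a c : Fin b) :
    projection (companionSum f t) U V k a c =
      Algebra.trace F (AdjoinRoot f) (AdjoinRoot.root f ^ k *
        (∑ j, Matrix.vecMulVec
          (blockCoordEquiv (powersBasis hmonic).traceDual b t U j)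
          (blockCoordEquiv (powersBasis hmonic) b t V j)) a c) := by
  have h1 : projection (companionSum f t) U V k a c =
      ∑ x, U x a * ((companionSum f t ^ k).mulVec (V.col c)) x := by
    have : projection (companionSum f t) U V k = U.transpose * (companionSum f t ^ k * V) :=
      Matrix.mul_assoc _ _ _
    rw [this, Matrix.mul_apply]
    rfl
  rw [h1, Fintype.sum_prod_type_right, Matrix.sum_apply, Finset.mul_sum, map_sum]
  refine Finset.sum_congr rfl fun j _ => ?_
  rw [Matrix.vecMulVec_apply, mul_left_comm]
  refine Eq.trans ?_ (trace_traceDual_mul _ _ _).symm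
  refine Finset.sum_congr rfl fun p _ => ?_
  rw [companionSum_pow_mulVec hmonic]
  rfl

omit [Finite F] in
theorem seqMul_apply_of_trace [Fact (Irreducible f)] {b : ℕ}
    {S : ℕ → Matrix (Fin b) (Fin b) F} {W : Matrix (Fin b) (Fin b) (AdjoinRoot f)}
    (hS : ∀ k a c, S k a c =
      Algebra.trace F (AdjoinRoot f) (AdjoinRoot.root f ^ k * W a c))
    (G : Matrix (Fin b) (Fin b) F[X]) (k : ℕ) (a c : Fin b) :
    seqMul S G k a c = Algebra.trace F (AdjoinRoot f)
      (AdjoinRoot.root f ^ k * (W * G.map (AdjoinRoot.mk f)) a c) := by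
  -- One bound for the matrix polynomial and all its entries lets every coefficient sum run over the
  -- same range.
  obtain ⟨N, hN1, hN2⟩ : ∃ N, (matPolyEquiv G).natDegree < N ∧
      ∀ i j, (G i j).natDegree < N := by
    refine ⟨(matPolyEquiv G).natDegree + ∑ i, ∑ j, (G i j).natDegree + 1, by omega, fun i j => ?_⟩
    have h1 := Finset.single_le_sum (f := fun j => (G i j).natDegree) (fun _ _ => Nat.zero_le _)
      (Finset.mem_univ j)
    have h2 := Finset.single_le_sum (f := fun i => ∑ j, (G i j).natDegree)
      (fun _ _ => Nat.zero_le _) (Finset.mem_univ i)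
    omega
  rw [seqMul, sum_over_range' _ (fun i => Matrix.mul_zero _) N hN1, Matrix.sum_apply,
    Matrix.mul_apply, Finset.mul_sum, map_sum]
  simp_rw [Matrix.mul_apply, matPolyEquiv_coeff_apply, hS]
  rw [Finset.sum_comm]
  refine Finset.sum_congr rfl fun m _ => ?_
  have hmk : AdjoinRoot.mk f (G m c) =
      ∑ i ∈ Finset.range N, (G m c).coeff i • AdjoinRoot.root f ^ i := by
    rw [← AdjoinRoot.aeval_eq, aeval_eq_sum_range' (hN2 m c)]
  rw [Matrix.map_apply, hmk, Finset.mul_sum, Finset.mul_sum, map_sum]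
  refine Finset.sum_congr rfl fun i _ => ?_
  rw [mul_smul_comm, mul_smul_comm, map_smul, smul_eq_mul, mul_comm, pow_add]
  congr 2
  ring

/-- The traces against all `root^k`, `k < d`, are the coordinates of an entry of `W G` in the
trace-dual basis, so their vanishing kills the entry. -/
theorem generates_iff_of_trace [Fact (Irreducible f)] [FiniteDimensional F (AdjoinRoot f)]
    (hmonic : f.Monic) {b : ℕ}
    {S : ℕ → Matrix (Fin b) (Fin b) F} {W : Matrix (Fin b) (Fin b) (AdjoinRoot f)}
    (hS : ∀ k a c, S k a c =
      Algebra.trace F (AdjoinRoot f) (AdjoinRoot.root f ^ k * W a c))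
    (G : Matrix (Fin b) (Fin b) F[X]) :
    Generates G S ↔ G.det ≠ 0 ∧ W * G.map (AdjoinRoot.mk f) = 0 := by
  refine and_congr_right fun _ => ⟨fun h => ?_, fun h k => ?_⟩
  · ext1 a c
    apply (powersBasis hmonic).traceDual.repr.injective
    ext1 i
    rw [Module.Basis.traceDual_repr_apply, Algebra.traceForm_apply, powersBasis_apply, mul_comm,
      ← seqMul_apply_of_trace hS, h]
    simp
  · ext1 a c
    rw [seqMul_apply_of_trace hS, h]
    simp

end Projection

/-! ### Faithfulness as a rank condition, and counting -/

section Probability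

variable {F : Type*} [Field F] [Finite F] {f : F[X]}

omit [Finite F] in
theorem exists_minimallyGenerates_faithful_iff [Fact (Irreducible f)] (hmonic : f.Monic)
    {n : Type*} [Fintype n] [DecidableEq n] {A : Matrix n n F} (hA : aeval A f = 0)
    {b r t : ℕ} (ht : Fintype.card n = t * f.natDegree) (hr : r ≤ t)
    {S : ℕ → Matrix (Fin b) (Fin b) F} {W : Matrix (Fin b) (Fin b) (AdjoinRoot f)}
    (hS : ∀ G, Generates G S ↔ G.det ≠ 0 ∧ W * G.map (AdjoinRoot.mk f) = 0) :
    (∃ G, MinimallyGenerates G S ∧ Faithful r G A) ↔ r ≤ W.rank := by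
  have hf : Irreducible f := Fact.out
  obtain ⟨H, hH, hmin⟩ := exists_minimal_annihilator W
  have hHmin : MinimallyGenerates H S :=
    ⟨(hS H).mpr hH, fun G hG => (hmin G ((hS G).mp hG).1 ((hS G).mp hG).2).1⟩
  have hlat : ∀ G, MinimallyGenerates G S →
      ∀ v, W.mulVec (AdjoinRoot.mk f ∘ v) = 0 → ∃ w, v = G.mulVec w := fun G hG =>
    (hmin G ((hS G).mp hG.1).1 ((hS G).mp hG.1).2).2 (hG.2 H hHmin.1)
  have hrank : ∀ G, MinimallyGenerates G S →
      Fintype.card (Fin b) - (G.map (AdjoinRoot.mk f)).rank = W.rank := fun G hG =>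
    rank_map_eq_of_kernel ((hS G).mp hG.1).2 (hlat G hG)
  have hAt : Fintype.card n - (A.charmatrix.map (AdjoinRoot.mk f)).rank = t :=
    Nat.eq_of_mul_eq_mul_right hf.natDegree_pos
      ((natDegree_mul_corank_charmatrix hmonic hA).trans ht)
  constructor
  · rintro ⟨G, hG, s, s', hs, hs', hss⟩
    by_contra! hlt
    -- If `rank W < r ≤ t`, the factor at index `rank W` is divisible by `f` for `xI - A` but not
    -- for `G`.
    have h1 := (hs'.dvd_iff (f := f) W.rank).mpr (by rw [hAt]; omega)
    rw [← hss _ hlt, hs.dvd_iff, hrank G hG] at h1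
    exact lt_irrefl _ h1
  · intro hle
    refine ⟨H, hHmin, _, _, isInvariantFactors_of_dvd hmonic hH.1 fun v => hlat H hHmin _ ?_,
      isInvariantFactors_of_dvd hmonic (charmatrix_det_ne_zero A)
        (exists_smul_eq_charmatrix_mulVec hA), fun i hi => ?_⟩
    · have : AdjoinRoot.mk f ∘ (f • v) = 0 := by ext i; simp
      rw [this, Matrix.mulVec_zero]
    · rw [hrank H hHmin, hAt, if_pos (by omega), if_pos (by omega)]

theorem rank_sum_vecMulVec_le {L : Type*} [Field L] {b t : ℕ} (u v : Fin t → Fin b → L) :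
    (∑ j, Matrix.vecMulVec (u j) (v j)).rank ≤ t := by
  have : ∑ j, Matrix.vecMulVec (u j) (v j) = (Matrix.of u).transpose * Matrix.of v := by
    ext i k
    simp [Matrix.sum_apply, Matrix.mul_apply, Matrix.vecMulVec_apply]
  rw [this]
  exact (Matrix.rank_mul_le_right _ _).trans (Matrix.rank_le_height _)

theorem sum_outerProductRankProb (L : Type*) [Field L] [Finite L] (b r t : ℕ) :
    ∑ i ∈ Finset.Icc r t, outerProductRankProb L b i t =
      (Nat.card {p : (Fin t → Fin b → L) × (Fin t → Fin b → L) //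
        r ≤ (∑ i, Matrix.vecMulVec (p.1 i) (p.2 i)).rank} : ℝ) /
      (Nat.card ((Fin t → Fin b → L) × (Fin t → Fin b → L)) : ℝ) := by
  classical
  have := Fintype.ofFinite ((Fin t → Fin b → L) × (Fin t → Fin b → L))
  simp only [outerProductRankProb]
  rw [← Finset.sum_div]
  congr 1
  norm_cast
  simp_rw [Nat.card_eq_fintype_card, Fintype.card_subtype]
  rw [Finset.card_eq_sum_card_fiberwise (t := Finset.Icc r t)
    (f := fun p => (∑ i, Matrix.vecMulVec (p.1 i) (p.2 i)).rank)]
  · refine Finset.sum_congr rfl fun i hi => ?_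
    rw [Finset.filter_filter]
    congr 1
    ext p
    simp only [Finset.mem_filter, Finset.mem_univ, true_and]
    have := (Finset.mem_Icc.mp hi).1
    exact ⟨fun h => ⟨h ▸ this, h⟩, fun h => h.2⟩
  · intro p hp
    simp only [Finset.coe_filter, Finset.mem_univ, true_and, Set.mem_ofPred_eq] at hp
    simpa using ⟨hp, rank_sum_vecMulVec_le p.1 p.2⟩

/-- A ring isomorphism carries a diagonal normal form to one with the same number of nonzero
entries. -/
theorem rank_map_ringEquiv {L K m : Type*} [Field L] [Field K] [Fintype m] [DecidableEq m]
    (e : L ≃+* K) (M : Matrix m m L) : (M.map e).rank = M.rank := by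
  classical
  obtain ⟨P, Q, g, hP, hQ, h⟩ := M.exists_rank_normal_form
  let D : m → L := fun i => Sum.elim (fun _ => 1) (fun _ => 0) (g i)
  have hD : P * M * Q = Matrix.diagonal D := by
    rw [h]
    ext i j
    rw [Matrix.submatrix_apply, Matrix.diagonal_apply]
    by_cases hij : i = j
    · subst hij
      rw [if_pos rfl]
      rcases hi : g i with x | x <;> simp [D, hi]
    · rw [if_neg hij]
      have hg : g i ≠ g j := fun h => hij (g.injective h)
      rcases hi : g i with x | x <;> rcases hj : g j with y | y <;> simp_all
  have hD' : P.map e * M.map e * Q.map e = Matrix.diagonal (e ∘ D) := by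
    have := congrArg (fun A : Matrix m m L => A.map e) hD
    simpa only [Matrix.map_mul, Matrix.diagonal_map (map_zero e), Function.comp_def] using this
  rw [rank_eq_card_of_equiv_diagonal hP hQ hD, rank_eq_card_of_equiv_diagonal
    (hP.map (e : L →+* K).mapMatrix) (hQ.map (e : L →+* K).mapMatrix) hD']
  exact Fintype.card_congr (Equiv.subtypeEquivRight fun i => by simp)

theorem outerProductRankProb_congr {L K : Type*} [Field L] [Field K] (e : L ≃+* K) (b i t : ℕ) :
    outerProductRankProb L b i t = outerProductRankProb K b i t := by
  let g : (Fin t → Fin b → L) ≃ (Fin t → Fin b → K) :=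
    Equiv.arrowCongr (Equiv.refl _) (Equiv.arrowCongr (Equiv.refl _) e.toEquiv)
  rw [outerProductRankProb, outerProductRankProb, Nat.card_congr (g.prodCongr g)]
  congr 2
  refine Nat.card_congr ((g.prodCongr g).subtypeEquiv fun p => ?_)
  rw [← rank_map_ringEquiv e]
  have : (∑ i, Matrix.vecMulVec (p.1 i) (p.2 i)).map e =
      ∑ i, Matrix.vecMulVec ((g.prodCongr g p).1 i) ((g.prodCongr g p).2 i) := by
    ext x y
    simp [g, Matrix.sum_apply, Matrix.vecMulVec_apply]
  rw [this]

theorem faithfulProb_companionSum [Fact (Irreducible f)] (hmonic : f.Monic) {b r t : ℕ}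
    (hr : r ≤ t) :
    faithfulProb b r (companionSum f t) =
      ∑ i ∈ Finset.Icc r t, outerProductRankProb (AdjoinRoot f) b i t := by
  have : FiniteDimensional F (AdjoinRoot f) := hmonic.finite_adjoinRoot
  have : Finite (AdjoinRoot f) := Module.finite_of_finite F
  let B := powersBasis hmonic
  let e := (blockCoordEquiv B.traceDual b t).prodCongr (blockCoordEquiv B b t)
  rw [sum_outerProductRankProb, faithfulProb, Nat.card_congr e]
  congr 2
  refine Nat.card_congr (e.subtypeEquiv fun p => ?_)
  exact exists_minimallyGenerates_faithful_iff hmonic (aeval_companionSum hmonic t)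
    (by simp [mul_comm]) hr
    (generates_iff_of_trace hmonic (projection_companionSum hmonic p.1 p.2))

end Probability

end BlockWiedemann

theorem mainTheorem8 {F : Type*} [Field F] [Finite F] {K : Type*} [Field K] [Finite K]
    (q d : ℕ) (hq : Nat.card F = q) (f : F[X]) (hf : Irreducible f) (hmonic : f.Monic)
    (hd : f.natDegree = d) (hK : Nat.card K = q ^ d) (b r t : ℕ) (hr : r ≤ t) :
    BlockWiedemann.faithfulProb b r (BlockWiedemann.companionSum f t) =
      ∑ i ∈ Finset.Icc r t, BlockWiedemann.outerProductRankProb K b i t := by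
  have : Fact (Irreducible f) := ⟨hf⟩
  have : FiniteDimensional F (AdjoinRoot f) := hmonic.finite_adjoinRoot
  have : Finite (AdjoinRoot f) := Module.finite_of_finite F
  have := Fintype.ofFinite (AdjoinRoot f)
  have := Fintype.ofFinite K
  have hcard : Nat.card (AdjoinRoot f) = Nat.card K := by
    rw [Module.natCard_eq_pow_finrank (K := F), (AdjoinRoot.powerBasis' hmonic).finrank, hK, hq,
      ← hd, AdjoinRoot.powerBasis'_dim]
  rw [BlockWiedemann.faithfulProb_companionSum hmonic hr]
  refine Finset.sum_congr rfl fun i _ => BlockWiedemann.outerProductRankProb_congr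
    (FiniteField.ringEquivOfCardEq (by simpa [Nat.card_eq_fintype_card] using hcard)) b i t
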